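/- Let $n\ge 1$ and let $x_1,\dots,x_n$ be independent random variables, each uniformly distributed on $\{1,\dots,n\}$. The algorithm LINEAR, run on the sequence $s=(x_1,\dots,x_n)$, starts with a vector $v=(v_1,\dots,v_n)$ of zeros and, for $i=1,2,\dots,n$ in turn, makes the comparison "$v_{s_i}>0$?": if it holds, LINEAR stops and returns FALSE; otherwise it increases $v_{s_i}$ by $1$ and goes on. If no comparison succeeds, it returns TRUE. Let $C_L=C_L(n)$ be the expected number of comparisons "$v_{s_i}>0$?" executed, and let $$R_1=R_1(n)=\sum_{k=1}^n p_k\,k,\qquad p_k=\frac{n!\,k}{(n-k)!\,n^{k+1}}\quad(1\le k\le n).$$ Then, for every $n\ge 1$, $$C_L = 1-\frac{n!}{n^n}+R_1=\sqrt{\frac{\pi n}{2}}+\frac23+\kappa(n)-\frac{n!}{n^n},$$ where $$\kappa(n)=\frac13-\sqrt{\frac{\pi n}{2}}+\sum_{k=1}^n\frac{n!\,k^2}{(n-k)!\,n^{k+1}},$$ and the sequence $(\kappa(n))_{n\ge1}$ is strictly decreasing and tends to $0$ as $n\to\infty$. -/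

import Mathlib

open MeasureTheory ProbabilityTheory Filter Topology
open scoped Nat

namespace Linear

/-- The main loop of the algorithm LINEAR. `v` is the current content of the working vector, the
list holds the entries `s_i, …, s_n` that are still to be examined. The result is the pair of the
returned truth value and the number of comparisons `v_{s_i} > 0` that were executed.
The alphabet `{1, …, n}` is represented by the `n`-element type `Fin n`. -/
def loop {n : ℕ} (v : Fin n → ℕ) : List (Fin n) → Bool × ℕ
  | [] => (true, 0)
  | a :: rest =>
    if v a > 0 then (false, 1)
    else
      let r := loop (Function.update v a (v a + 1)) rest
      (r.1, r.2 + 1)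

/-- LINEAR run on the sequence `s`: the working vector starts as the zero vector, and the entries
of `s` are examined from the first to the last. -/
def run {n : ℕ} (s : Fin n → Fin n) : Bool × ℕ :=
  loop (fun _ => 0) (List.ofFn s)

/-- The truth value returned by LINEAR on the input `s`. -/
def output {n : ℕ} (s : Fin n → Fin n) : Bool := (run s).1

/-- The number of comparisons executed by LINEAR on the input `s`. -/
def comparisons {n : ℕ} (s : Fin n → Fin n) : ℕ := (run s).2

/-- `p_k(n) = n! k / ((n - k)! n ^ (k + 1))`, for `1 ≤ k ≤ n`. -/
noncomputable def p (n k : ℕ) : ℝ :=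
  ((n ! : ℝ) * k) / (((n - k)! : ℝ) * (n : ℝ) ^ (k + 1))

/-- `R_i(n) = ∑_{k = 1}^n p_k(n) k ^ i`. -/
noncomputable def R (i n : ℕ) : ℝ :=
  ∑ k ∈ Finset.Icc 1 n, p n k * (k : ℝ) ^ i

/-- `κ(n) = 1/3 - √(π n / 2) + ∑_{k = 1}^n n! k² / ((n - k)! n ^ (k + 1))`. -/
noncomputable def kappa (n : ℕ) : ℝ :=
  1 / 3 - √(Real.pi * n / 2) +
    ∑ k ∈ Finset.Icc 1 n, ((n ! : ℝ) * (k : ℝ) ^ 2) / (((n - k)! : ℝ) * (n : ℝ) ^ (k + 1))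

end Linear

/-!
The expected cost is the sum of the probabilities that the first `k` entries are distinct, `k < n`,
and Abel summation of `R 1 n` gives the same sum with the additional term `k = n`.

By the binomial theorem the sum including `k = n` equals `n * ∫ (1 + t) ^ n * e ^ (-n * t) dt` over
`t > 0`. Substituting `v = phase t = t - log (1 + t)` turns this into
`n * ∫ e ^ (-n * v) * (1 + 1 / t) dv`, where `t = phaseInv v`. Now `1 + 1 / t`, the derivative of
`phaseInv` at `v`, is `1 / √(2 * v) + 2 / 3 + o(1)` as `v → 0`, and the two explicit terms
contribute `√(π * n / 2) + 2 / 3`. Hence `kappa n` is the integral of what is left: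
`kappa n = n * ∫ e ^ (-n * v) * remainder (phaseInv v) dv
  = ∫ e ^ (-w) * remainder (phaseInv (w / n)) dw`.
The bounds `3 * t / (3 + t) < √(2 * phase t) < t / (1 + t) ^ (1 / 3)` show that `remainder`
lies between `0` and `1 / 3`, tends to `0` at `0` and is strictly increasing. So the last
integrand strictly decreases in `n`, and dominated convergence sends the integral to `0`.
-/

namespace Linear

/-! ### The expected number of comparisons -/

theorem card_filter_update_eq_zero_add_one {α : Type*} [Fintype α] [DecidableEq α] {v : α → ℕ}
    {a : α} (ha : v a = 0) {c : ℕ} (hc : c ≠ 0) :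
    (Finset.univ.filter fun b => Function.update v a c b = 0).card + 1
      = (Finset.univ.filter fun b => v b = 0).card := by
  have herase : (Finset.univ.filter fun b => Function.update v a c b = 0)
      = (Finset.univ.filter fun b => v b = 0).erase a := by
    ext b
    rcases eq_or_ne b a with rfl | hb <;> simp [*]
  rw [herase, Finset.card_erase_add_one (by simpa using ha)]

theorem sum_loop_cons {n m : ℕ} (v : Fin n → ℕ) (a : Fin n) :
    ∑ s : Fin m → Fin n, (loop v (a :: List.ofFn s)).2
      = n ^ m + if v a = 0 then
          ∑ s : Fin m → Fin n, (loop (Function.update v a (v a + 1)) (List.ofFn s)).2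
        else 0 := by
  rcases Nat.eq_zero_or_pos (v a) with ha | ha
  · simp [loop, ha, Finset.sum_add_distrib, add_comm]
  · simp [loop, ha, ha.ne']

theorem sum_loop {n : ℕ} (m : ℕ) (v : Fin n → ℕ) :
    ∑ s : Fin m → Fin n, (loop v (List.ofFn s)).2
      = ∑ k ∈ Finset.range m,
          n ^ (m - k) * (Finset.univ.filter fun a => v a = 0).card.descFactorial k := by
  induction m generalizing v with
  | zero => simp [loop]
  | succ m ih =>
    set free := Finset.univ.filter fun a => v a = 0 with hfree
    have hseen : ∀ a ∈ free,
        ∑ s : Fin m → Fin n, (loop (Function.update v a (v a + 1)) (List.ofFn s)).2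
          = ∑ k ∈ Finset.range m, n ^ (m - k) * (free.card - 1).descFactorial k := by
      intro a ha
      have hcard := card_filter_update_eq_zero_add_one (Finset.mem_filter.1 ha).2
        (Nat.succ_ne_zero (v a))
      rw [ih, hfree, ← hcard, Nat.add_sub_cancel]
    have hdesc : ∀ k, free.card * (free.card - 1).descFactorial k
        = free.card.descFactorial (k + 1) := by
      intro k
      cases free.card with
      | zero => simp
      | succ d => rw [Nat.succ_descFactorial_succ, Nat.add_sub_cancel]
    calc ∑ s : Fin (m + 1) → Fin n, (loop v (List.ofFn s)).2
        = ∑ a : Fin n, ∑ s : Fin m → Fin n, (loop v (a :: List.ofFn s)).2 := by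
          rw [← (Fin.consEquiv fun _ : Fin (m + 1) => Fin n).sum_comp, Fintype.sum_prod_type]
          simp only [Fin.consEquiv_apply, List.ofFn_succ, Fin.cons_zero, Fin.cons_succ]
      _ = n ^ (m + 1) + ∑ a ∈ free,
            ∑ s : Fin m → Fin n, (loop (Function.update v a (v a + 1)) (List.ofFn s)).2 := by
          simp only [sum_loop_cons, Finset.sum_add_distrib, ← Finset.sum_filter]
          simp [free, pow_succ']
      _ = n ^ (m + 1) + ∑ k ∈ Finset.range m, n ^ (m - k) * free.card.descFactorial (k + 1) := by
          rw [Finset.sum_congr rfl hseen, Finset.sum_const, smul_eq_mul, Finset.mul_sum]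
          simp only [mul_left_comm free.card, hdesc]
      _ = ∑ k ∈ Finset.range (m + 1), n ^ (m + 1 - k) * free.card.descFactorial k := by
          rw [Finset.sum_range_succ', add_comm]
          simp

/-- The probability that the first `k` entries of a uniform sequence over an `n`-element alphabet
are pairwise distinct, that is, that LINEAR makes more than `k` comparisons when `k < n`. -/
noncomputable def distinctProb (n k : ℕ) : ℝ := n.descFactorial k / (n : ℝ) ^ k

theorem distinctProb_self (n : ℕ) : distinctProb n n = (n ! : ℝ) / (n : ℝ) ^ n := by
  rw [distinctProb, Nat.descFactorial_self]

theorem p_eq_distinctProb_sub {n k : ℕ} (hk : 1 ≤ k) (hkn : k ≤ n) :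
    p n k = distinctProb n k - distinctProb n (k + 1) := by
  have hn : (n : ℝ) ≠ 0 := by exact_mod_cast (Nat.lt_of_lt_of_le hk hkn).ne'
  have hfac : ((n - k)! : ℝ) * n.descFactorial k = n ! := by
    exact_mod_cast Nat.factorial_mul_descFactorial hkn
  have hfac0 : ((n - k)! : ℝ) ≠ 0 := by positivity
  rw [p, distinctProb, distinctProb, Nat.descFactorial_succ, ← hfac]
  push_cast [hkn]
  field_simp
  ring

theorem sum_Icc_sub_succ_mul (d : ℕ → ℝ) (m : ℕ) :
    ∑ k ∈ Finset.Icc 1 m, (d k - d (k + 1)) * k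
      = ∑ k ∈ Finset.Icc 1 m, d k - m * d (m + 1) := by
  induction m with
  | zero => simp
  | succ m ih =>
    rw [Finset.sum_Icc_succ_top (by lia), Finset.sum_Icc_succ_top (by lia), ih]
    push_cast
    ring

theorem one_add_R_one (n : ℕ) :
    1 + R 1 n = ∑ k ∈ Finset.range (n + 1), distinctProb n k := by
  have hzero : distinctProb n 0 = 1 := by simp [distinctProb]
  have hlast : distinctProb n (n + 1) = 0 := by simp [distinctProb]
  have hR : R 1 n = ∑ k ∈ Finset.Icc 1 n, distinctProb n k := by
    calc R 1 n = ∑ k ∈ Finset.Icc 1 n, (distinctProb n k - distinctProb n (k + 1)) * k :=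
          Finset.sum_congr rfl fun k hk => by
            rw [p_eq_distinctProb_sub (Finset.mem_Icc.1 hk).1 (Finset.mem_Icc.1 hk).2, pow_one]
      _ = ∑ k ∈ Finset.Icc 1 n, distinctProb n k := by
          rw [sum_Icc_sub_succ_mul, hlast, mul_zero, sub_zero]
  rw [hR, Finset.range_eq_Ico, Finset.sum_eq_sum_Ico_succ_bot n.add_one_pos, hzero, zero_add,
    Finset.Ico_add_one_right_eq_Icc]

theorem sum_comparisons_div (n : ℕ) :
    (∑ s : Fin n → Fin n, (comparisons s : ℝ)) / (n : ℝ) ^ n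
      = ∑ k ∈ Finset.range n, distinctProb n k := by
  have hsum : ∑ s : Fin n → Fin n, comparisons s
      = ∑ k ∈ Finset.range n, n ^ (n - k) * n.descFactorial k := by
    simpa [comparisons, run] using sum_loop n fun _ : Fin n => 0
  rw [← Nat.cast_sum, hsum, Nat.cast_sum, Finset.sum_div]
  refine Finset.sum_congr rfl fun k hk => ?_
  have hkn : k < n := Finset.mem_range.1 hk
  have hn : (n : ℝ) ≠ 0 := by exact_mod_cast (k.zero_le.trans_lt hkn).ne'
  rw [distinctProb, ← pow_sub_mul_pow (n : ℝ) hkn.le]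
  push_cast
  field_simp

theorem integral_comp_of_iIndepFun_of_uniform {ι α Ω : Type*} [Fintype ι] [DecidableEq ι]
    [Fintype α] [MeasurableSpace α] [MeasurableSingletonClass α] [MeasurableSpace Ω] {P : Measure Ω}
    {x : ι → Ω → α} (hx : ∀ i, Measurable (x i)) (hind : iIndepFun x P)
    (hunif : ∀ i a, P.real {ω | x i ω = a} = 1 / (Fintype.card α : ℝ)) (f : (ι → α) → ℝ) :
    ∫ ω, f (fun i => x i ω) ∂P = (∑ s, f s) / (Fintype.card α : ℝ) ^ Fintype.card ι := by
  have : IsProbabilityMeasure P := hind.isProbabilityMeasure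
  have hX : Measurable fun ω i => x i ω := measurable_pi_lambda _ hx
  have hmass : ∀ s : ι → α, (P.map fun ω i => x i ω).real {s}
      = 1 / (Fintype.card α : ℝ) ^ Fintype.card ι := by
    intro s
    have hpre : (fun ω i => x i ω) ⁻¹' {s} = ⋂ i, {ω | x i ω = s i} := by
      ext ω
      simp [funext_iff]
    have hprod : P (⋂ i, {ω | x i ω = s i}) = ∏ i, P {ω | x i ω = s i} :=
      hind.meas_iInter fun i => ⟨{s i}, measurableSet_singleton _, rfl⟩
    rw [map_measureReal_apply hX (measurableSet_singleton s), hpre, measureReal_def, hprod,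
      ENNReal.toReal_prod]
    simp only [← measureReal_def, hunif, Finset.prod_const, Finset.card_univ, one_div_pow]
  rw [← integral_map hX.aemeasurable (measurable_of_finite f).aestronglyMeasurable,
    integral_fintype .of_finite, Finset.sum_div]
  exact Finset.sum_congr rfl fun s _ => by rw [hmass, smul_eq_mul, one_div_mul_eq_div]

theorem integral_comparisons {n : ℕ} {Ω : Type*} [MeasurableSpace Ω] {P : Measure Ω}
    {x : Fin n → Ω → Fin n} (hx : ∀ i, Measurable (x i)) (hind : iIndepFun x P)
    (hunif : ∀ i k, P.real {ω | x i ω = k} = 1 / (n : ℝ)) :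
    ∫ ω, (comparisons (fun i => x i ω) : ℝ) ∂P = 1 - (n ! : ℝ) / (n : ℝ) ^ n + R 1 n := by
  rw [integral_comp_of_iIndepFun_of_uniform hx hind (by simpa using hunif)
      fun s => (comparisons s : ℝ), Fintype.card_fin, sum_comparisons_div, ← distinctProb_self]
  linarith [one_add_R_one n, Finset.sum_range_succ (distinctProb n) n]

theorem kappa_eq (n : ℕ) : kappa n = 1 / 3 - √(Real.pi * n / 2) + R 1 n := by
  rw [kappa, R]
  congr 1
  refine Finset.sum_congr rfl fun k _ => ?_
  rw [p]
  ring

/-! ### The phase and its inverse -/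

/-- The phase of the Laplace integral `∫ e ^ (-n * phase t) dt`, whose integrand is
`(1 + t) ^ n * e ^ (-n * t)`. -/
noncomputable def phase (t : ℝ) : ℝ := t - Real.log (1 + t)

theorem exp_neg_mul_phase (n : ℕ) {t : ℝ} (ht : -1 < t) :
    Real.exp (-(n * phase t)) = (1 + t) ^ n * Real.exp (-(n * t)) := by
  rw [← Real.exp_log (pow_pos (show 0 < 1 + t by linarith) n), Real.log_pow, ← Real.exp_add, phase]
  ring_nf

theorem hasDerivAt_phase {t : ℝ} (ht : -1 < t) : HasDerivAt phase (t / (1 + t)) t := by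
  have hne : 1 + t ≠ 0 := by linarith
  refine ((hasDerivAt_id t).sub (((hasDerivAt_id t).const_add 1).log hne)).congr_deriv ?_
  simp only [id]
  field_simp
  ring

theorem strictMonoOn_of_hasDerivAt_pos {D : Set ℝ} (hD : Convex ℝ D) {f f' : ℝ → ℝ}
    (hf : ∀ x ∈ D, HasDerivAt f (f' x) x) (hpos : ∀ x ∈ interior D, 0 < f' x) :
    StrictMonoOn f D :=
  strictMonoOn_of_hasDerivWithinAt_pos hD
    (fun x hx => (hf x hx).continuousAt.continuousWithinAt)
    (fun x hx => (hf x (interior_subset hx)).hasDerivWithinAt) hpos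

theorem strictMonoOn_phase : StrictMonoOn phase (Set.Ici 0) := by
  refine strictMonoOn_of_hasDerivAt_pos (convex_Ici 0)
    (fun t ht => hasDerivAt_phase (by linarith [Set.mem_Ici.1 ht])) fun t ht => ?_
  rw [interior_Ici, Set.mem_Ioi] at ht
  positivity

theorem phase_zero : phase 0 = 0 := by simp [phase]

theorem phase_pos {t : ℝ} (ht : 0 < t) : 0 < phase t :=
  phase_zero ▸ strictMonoOn_phase Set.self_mem_Ici ht.le ht

theorem le_phase_two_mul_add_one {v : ℝ} (hv : 0 ≤ v) : v ≤ phase (2 * v + 1) := by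
  have hlog : Real.log (1 + (2 * v + 1)) = Real.log 2 + Real.log (1 + v) := by
    rw [← Real.log_mul two_ne_zero (by positivity)]
    ring_nf
  have htwo : Real.log 2 ≤ 2 - 1 := Real.log_le_sub_one_of_pos two_pos
  have hone : Real.log (1 + v) ≤ 1 + v - 1 := Real.log_le_sub_one_of_pos (by positivity)
  rw [phase, hlog]
  linarith

theorem bijOn_phase : Set.BijOn phase (Set.Ioi 0) (Set.Ioi 0) := by
  refine ⟨fun t ht => phase_pos ht, (strictMonoOn_phase.mono Set.Ioi_subset_Ici_self).injOn,
    fun v hv => ?_⟩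
  have hv : 0 < v := hv
  have hcont : ContinuousOn phase (Set.Icc 0 (2 * v + 1)) := fun t ht =>
    (hasDerivAt_phase (by linarith [ht.1])).continuousAt.continuousWithinAt
  obtain ⟨t, ht, rfl⟩ := intermediate_value_Icc (by positivity) hcont
    ⟨phase_zero.trans_le hv.le, le_phase_two_mul_add_one hv.le⟩
  refine ⟨t, ht.1.lt_of_ne ?_, rfl⟩
  rintro rfl
  exact hv.ne' phase_zero

/-- The inverse of `phase` on `(0, ∞)`; its values at other arguments are irrelevant. -/
noncomputable def phaseInv : ℝ → ℝ := Function.invFunOn phase (Set.Ioi 0)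

theorem phaseInv_phase {t : ℝ} (ht : 0 < t) : phaseInv (phase t) = t :=
  bijOn_phase.invOn_invFunOn.1 ht

theorem phase_phaseInv {v : ℝ} (hv : 0 < v) : phase (phaseInv v) = v :=
  bijOn_phase.invOn_invFunOn.2 hv

theorem phaseInv_pos {v : ℝ} (hv : 0 < v) : 0 < phaseInv v :=
  bijOn_phase.surjOn.mapsTo_invFunOn hv

theorem phaseInv_lt_iff {v t : ℝ} (hv : 0 < v) (ht : 0 < t) : phaseInv v < t ↔ v < phase t := by
  rw [← strictMonoOn_phase.lt_iff_lt (phaseInv_pos hv).le ht.le, phase_phaseInv hv]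

theorem strictMonoOn_phaseInv : StrictMonoOn phaseInv (Set.Ioi 0) := fun v hv w hw hvw => by
  rwa [phaseInv_lt_iff hv (phaseInv_pos hw), phase_phaseInv hw]

theorem tendsto_phaseInv : Tendsto phaseInv (𝓝[>] 0) (𝓝[>] 0) := by
  refine tendsto_nhdsWithin_iff.2 ⟨tendsto_order.2 ⟨fun a ha => ?_, fun a ha => ?_⟩, ?_⟩
  · filter_upwards [self_mem_nhdsWithin] with v hv using ha.trans (phaseInv_pos hv)
  · filter_upwards [Ioo_mem_nhdsGT (phase_pos ha)] with v hv
    exact (phaseInv_lt_iff hv.1 ha).2 hv.2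
  · filter_upwards [self_mem_nhdsWithin] with v hv using phaseInv_pos hv

theorem integral_comp_phase (f : ℝ → ℝ) :
    ∫ t in Set.Ioi 0, t / (1 + t) * f (phase t) = ∫ v in Set.Ioi 0, f v := by
  have h := integral_image_eq_integral_deriv_smul_of_monotoneOn measurableSet_Ioi
    (fun t ht => (hasDerivAt_phase (by linarith [Set.mem_Ioi.1 ht])).hasDerivWithinAt)
    (strictMonoOn_phase.monotoneOn.mono Set.Ioi_subset_Ici_self) f
  rw [bijOn_phase.image_eq] at h
  exact h.symm

theorem integrableOn_comp_phase_iff {f : ℝ → ℝ} :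
    IntegrableOn (fun t => t / (1 + t) * f (phase t)) (Set.Ioi 0) ↔ IntegrableOn f (Set.Ioi 0) := by
  have h := integrableOn_image_iff_integrableOn_deriv_smul_of_monotoneOn measurableSet_Ioi
    (fun t ht => (hasDerivAt_phase (by linarith [Set.mem_Ioi.1 ht])).hasDerivWithinAt)
    (strictMonoOn_phase.monotoneOn.mono Set.Ioi_subset_Ici_self) f
  rw [bijOn_phase.image_eq] at h
  exact h.symm

/-! ### The remainder -/

theorem log_one_add_lt {t : ℝ} (ht : 0 < t) :
    Real.log (1 + t) < t - 9 * t ^ 2 / (2 * (3 + t) ^ 2) := by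
  let gap : ℝ → ℝ := fun t => phase t - 9 * t ^ 2 / (2 * (3 + t) ^ 2)
  have hderiv : ∀ t ∈ Set.Ici (0 : ℝ),
      HasDerivAt gap (t ^ 3 * (9 + t) / ((1 + t) * (3 + t) ^ 3)) t := by
    intro t ht
    have ht : 0 ≤ t := ht
    have hquot := (((hasDerivAt_id t).pow 2).const_mul 9).div
      ((((hasDerivAt_id t).const_add 3).pow 2).const_mul 2)
      (show 2 * (3 + t) ^ 2 ≠ 0 by positivity)
    refine ((hasDerivAt_phase (by linarith)).sub hquot).congr_deriv ?_
    simp only [id, Pi.pow_apply]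
    field_simp
    ring
  have hmono : StrictMonoOn gap (Set.Ici 0) :=
    strictMonoOn_of_hasDerivAt_pos (convex_Ici 0) hderiv fun t ht => by
      rw [interior_Ici, Set.mem_Ioi] at ht
      positivity
  have h := hmono Set.self_mem_Ici ht.le ht
  simp only [gap, phase] at h
  norm_num at h
  linarith

theorem pow_three_sub_one_sub_log_lt {s : ℝ} (hs : 1 < s) :
    s ^ 3 - 1 - 3 * Real.log s < (s ^ 3 - 1) ^ 2 / (2 * s ^ 2) := by
  let gap : ℝ → ℝ := fun s => (s ^ 3 - 1) ^ 2 / (2 * s ^ 2) - (s ^ 3 - 1 - 3 * Real.log s)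
  have hderiv : ∀ s ∈ Set.Ici (1 : ℝ),
      HasDerivAt gap ((s - 1) ^ 3 * (2 * s + 1) * (s ^ 2 + s + 1) / s ^ 3) s := by
    intro s hs
    have hs0 : 0 < s := one_pos.trans_le hs
    have hcube := ((hasDerivAt_id s).pow 3).sub_const 1
    have hquot := (hcube.pow 2).div (((hasDerivAt_id s).pow 2).const_mul 2)
      (show 2 * s ^ 2 ≠ 0 by positivity)
    refine (hquot.sub (hcube.sub ((Real.hasDerivAt_log hs0.ne').const_mul 3))).congr_deriv ?_
    simp only [id, Pi.pow_apply]
    field_simp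
    ring
  have hmono : StrictMonoOn gap (Set.Ici 1) :=
    strictMonoOn_of_hasDerivAt_pos (convex_Ici 1) hderiv fun s hs => by
      rw [interior_Ici, Set.mem_Ioi] at hs
      have : 0 < s - 1 := sub_pos.2 hs
      positivity
  have h := hmono Set.self_mem_Ici hs.le hs
  simp only [gap] at h
  norm_num at h
  linarith

theorem lt_sqrt_two_mul_phase {t : ℝ} (ht : 0 < t) : 3 * t / (3 + t) < √(2 * phase t) := by
  refine Real.lt_sqrt_of_sq_lt ?_
  have hsq : (3 * t / (3 + t)) ^ 2 = 2 * (9 * t ^ 2 / (2 * (3 + t) ^ 2)) := by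
    field_simp
    ring
  rw [hsq, phase]
  linarith [log_one_add_lt ht]

theorem sqrt_two_mul_phase_lt {t : ℝ} (ht : 0 < t) :
    √(2 * phase t) < t / (1 + t) ^ (1 / 3 : ℝ) := by
  set s := (1 + t) ^ (1 / 3 : ℝ) with hs
  have hs1 : 1 < s := Real.one_lt_rpow (by linarith) (by norm_num)
  have hcube : s ^ 3 = 1 + t := by
    rw [hs, ← Real.rpow_natCast, ← Real.rpow_mul (by positivity)]
    norm_num
  have hphase : phase t = s ^ 3 - 1 - 3 * Real.log s := by
    rw [phase, ← hcube, Real.log_pow]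
    push_cast
    rw [hcube]
    ring
  rw [Real.sqrt_lt' (by positivity)]
  calc 2 * phase t < 2 * ((s ^ 3 - 1) ^ 2 / (2 * s ^ 2)) := by
        rw [hphase]
        linarith [pow_three_sub_one_sub_log_lt hs1]
    _ = (t / s) ^ 2 := by
        rw [hcube]
        field_simp
        ring

/-- For `t = phaseInv v` the derivative of `phaseInv` at `v` is `1 + 1 / t`; `remainder t` is what
is left of it after subtracting the terms `1 / √(2 * v) + 2 / 3` of its expansion at `v = 0`. -/
noncomputable def remainder (t : ℝ) : ℝ := 1 / 3 + 1 / t - 1 / √(2 * phase t)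

theorem sqrt_two_mul_phase_pos {t : ℝ} (ht : 0 < t) : 0 < √(2 * phase t) :=
  Real.sqrt_pos.2 (mul_pos two_pos (phase_pos ht))

theorem remainder_pos {t : ℝ} (ht : 0 < t) : 0 < remainder t := by
  have hinv : 1 / √(2 * phase t) < 1 / (3 * t / (3 + t)) :=
    one_div_lt_one_div_of_lt (by positivity) (lt_sqrt_two_mul_phase ht)
  have hsum : 1 / (3 * t / (3 + t)) = 1 / 3 + 1 / t := by
    field_simp
    ring
  rw [remainder]
  linarith

theorem remainder_lt {t : ℝ} (ht : 0 < t) :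
    remainder t < 1 / 3 - t⁻¹ * ((1 + t) ^ (1 / 3 : ℝ) - 1) := by
  have hinv : 1 / (t / (1 + t) ^ (1 / 3 : ℝ)) < 1 / √(2 * phase t) :=
    one_div_lt_one_div_of_lt (sqrt_two_mul_phase_pos ht) (sqrt_two_mul_phase_lt ht)
  rw [one_div_div, div_eq_inv_mul] at hinv
  rw [remainder, one_div t]
  linarith

theorem remainder_lt_one_third {t : ℝ} (ht : 0 < t) : remainder t < 1 / 3 := by
  have hroot : 1 ≤ (1 + t) ^ (1 / 3 : ℝ) := Real.one_le_rpow (by linarith) (by norm_num)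
  have hnonneg : 0 ≤ t⁻¹ * ((1 + t) ^ (1 / 3 : ℝ) - 1) :=
    mul_nonneg (inv_nonneg.2 ht.le) (sub_nonneg.2 hroot)
  linarith [remainder_lt ht]

theorem tendsto_remainder : Tendsto remainder (𝓝[>] 0) (𝓝 0) := by
  have hslope : Tendsto (fun t : ℝ => t⁻¹ * ((1 + t) ^ (1 / 3 : ℝ) - 1)) (𝓝[>] 0)
      (𝓝 (1 / 3)) := by
    simpa using
      (Real.hasDerivAt_rpow_const (x := 1) (p := 1 / 3) (.inl one_ne_zero)).tendsto_slope_zero_right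
  refine tendsto_of_tendsto_of_tendsto_of_le_of_le' tendsto_const_nhds
    (sub_self (1 / 3 : ℝ) ▸ hslope.const_sub (1 / 3)) ?_ ?_
  · filter_upwards [self_mem_nhdsWithin] with t ht using (remainder_pos ht).le
  · filter_upwards [self_mem_nhdsWithin] with t ht using (remainder_lt ht).le

theorem hasDerivAt_remainder {t : ℝ} (ht : 0 < t) :
    HasDerivAt remainder (t / ((1 + t) * √(2 * phase t) ^ 3) - 1 / t ^ 2) t := by
  have hsqrt := sqrt_two_mul_phase_pos ht
  have hroot := ((hasDerivAt_phase (by linarith : -1 < t)).const_mul 2).sqrt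
    (mul_pos two_pos (phase_pos ht)).ne'
  have hinv := ((hasDerivAt_inv ht.ne').const_add (1 / 3)).sub (hroot.inv hsqrt.ne')
  refine (hinv.congr_of_eventuallyEq (.of_eq ?_)).congr_deriv ?_
  · ext u
    simp [remainder]
  · field_simp
    ring

theorem strictMonoOn_remainder : StrictMonoOn remainder (Set.Ioi 0) := by
  refine strictMonoOn_of_hasDerivAt_pos (convex_Ioi 0) (fun t ht => hasDerivAt_remainder ht)
    fun t ht => ?_
  rw [interior_Ioi, Set.mem_Ioi] at ht
  have hsqrt := sqrt_two_mul_phase_pos ht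
  have hcube : (1 + t) * √(2 * phase t) ^ 3 < t ^ 3 := by
    calc (1 + t) * √(2 * phase t) ^ 3 < (1 + t) * (t / (1 + t) ^ (1 / 3 : ℝ)) ^ 3 := by
          gcongr
          exact sqrt_two_mul_phase_lt ht
      _ = t ^ 3 := by
          rw [div_pow, ← Real.rpow_mul_natCast (by positivity)]
          norm_num
          field_simp
  rw [sub_pos]
  calc 1 / t ^ 2 = t / t ^ 3 := by field_simp
    _ < t / ((1 + t) * √(2 * phase t) ^ 3) := by gcongr

/-! ### The integral representation of `kappa` -/

theorem integrableOn_rpow_mul_exp_neg_mul {a c : ℝ} (ha : 0 < a) (hc : 0 < c) :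
    IntegrableOn (fun t : ℝ => t ^ (a - 1) * Real.exp (-(c * t))) (Set.Ioi 0) := by
  simpa using integrableOn_rpow_mul_exp_neg_mul_rpow (by linarith : -1 < a - 1) one_pos hc

theorem integrableOn_pow_mul_exp_neg_mul (k : ℕ) {c : ℝ} (hc : 0 < c) :
    IntegrableOn (fun t : ℝ => t ^ k * Real.exp (-(c * t))) (Set.Ioi 0) := by
  simpa using integrableOn_rpow_mul_exp_neg_mul (k.cast_add_one_pos) hc

theorem integral_pow_mul_exp_neg_mul (k : ℕ) {c : ℝ} (hc : 0 < c) :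
    ∫ t in Set.Ioi 0, t ^ k * Real.exp (-(c * t)) = k ! / c ^ (k + 1) := by
  have h := Real.integral_rpow_mul_exp_neg_mul_Ioi (k.cast_add_one_pos) hc
  rw [Real.Gamma_nat_eq_factorial, ← Nat.cast_add_one, Real.rpow_natCast] at h
  simpa [div_eq_inv_mul] using h

theorem eqOn_exp_neg_mul_div_sqrt (c : ℝ) :
    Set.EqOn (fun v : ℝ => Real.exp (-(c * v)) / √(2 * v))
      (fun v => (√2)⁻¹ * (v ^ (1 / 2 - 1 : ℝ) * Real.exp (-(c * v)))) (Set.Ioi 0) := by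
  intro v hv
  have hpow : v ^ (1 / 2 - 1 : ℝ) = (√v)⁻¹ := by
    rw [Real.sqrt_eq_rpow, ← Real.rpow_neg (le_of_lt hv)]
    norm_num
  simp only
  rw [hpow, Real.sqrt_mul zero_le_two]
  ring

theorem integrableOn_exp_neg_mul_div_sqrt {c : ℝ} (hc : 0 < c) :
    IntegrableOn (fun v : ℝ => Real.exp (-(c * v)) / √(2 * v)) (Set.Ioi 0) :=
  IntegrableOn.congr_fun ((integrableOn_rpow_mul_exp_neg_mul one_half_pos hc).const_mul _)
    (eqOn_exp_neg_mul_div_sqrt c).symm measurableSet_Ioi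

theorem integral_exp_neg_mul_div_sqrt {c : ℝ} (hc : 0 < c) :
    ∫ v in Set.Ioi 0, Real.exp (-(c * v)) / √(2 * v) = √(Real.pi / (2 * c)) := by
  rw [setIntegral_congr_fun measurableSet_Ioi (eqOn_exp_neg_mul_div_sqrt c), integral_const_mul,
    Real.integral_rpow_mul_exp_neg_mul_Ioi one_half_pos hc, Real.Gamma_one_half_eq,
    ← Real.sqrt_eq_rpow, ← Real.sqrt_mul (by positivity), ← Real.sqrt_inv,
    ← Real.sqrt_mul (by positivity)]
  congr 1
  field_simp

theorem one_add_pow_mul_exp_neg_mul (n : ℕ) (c t : ℝ) :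
    (1 + t) ^ n * Real.exp (-(c * t))
      = ∑ k ∈ Finset.range (n + 1), n.choose k * (t ^ k * Real.exp (-(c * t))) := by
  rw [add_comm, add_pow, Finset.sum_mul]
  refine Finset.sum_congr rfl fun k _ => ?_
  ring

theorem integrableOn_one_add_pow_mul_exp_neg_mul (n : ℕ) {c : ℝ} (hc : 0 < c) :
    IntegrableOn (fun t : ℝ => (1 + t) ^ n * Real.exp (-(c * t))) (Set.Ioi 0) := by
  simp only [one_add_pow_mul_exp_neg_mul]
  exact integrable_finsetSum _ fun k _ => (integrableOn_pow_mul_exp_neg_mul k hc).const_mul _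

theorem integral_one_add_pow_mul_exp_neg_mul (n : ℕ) {c : ℝ} (hc : 0 < c) :
    ∫ t in Set.Ioi 0, (1 + t) ^ n * Real.exp (-(c * t))
      = ∑ k ∈ Finset.range (n + 1), n.descFactorial k / c ^ (k + 1) := by
  simp only [one_add_pow_mul_exp_neg_mul]
  rw [integral_finsetSum _ fun k _ => (integrableOn_pow_mul_exp_neg_mul k hc).const_mul _]
  refine Finset.sum_congr rfl fun k _ => ?_
  rw [integral_const_mul, integral_pow_mul_exp_neg_mul k hc,
    Nat.descFactorial_eq_factorial_mul_choose]
  push_cast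
  ring

theorem eqOn_exp_neg_mul_one_add_inv_phaseInv (n : ℕ) :
    Set.EqOn
      (fun t => t / (1 + t) * (Real.exp (-(n * phase t)) * (1 + 1 / phaseInv (phase t))))
      (fun t => (1 + t) ^ n * Real.exp (-(n * t))) (Set.Ioi 0) := by
  intro t ht
  have ht : 0 < t := ht
  simp only [phaseInv_phase ht, exp_neg_mul_phase n (by linarith : -1 < t)]
  field_simp
  ring

theorem integrableOn_exp_neg_mul_one_add_inv_phaseInv {n : ℕ} (hn : 0 < n) :
    IntegrableOn (fun v : ℝ => Real.exp (-(n * v)) * (1 + 1 / phaseInv v)) (Set.Ioi 0) :=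
  integrableOn_comp_phase_iff.1 <|
    (integrableOn_one_add_pow_mul_exp_neg_mul n (Nat.cast_pos.2 hn)).congr_fun
      (eqOn_exp_neg_mul_one_add_inv_phaseInv n).symm measurableSet_Ioi

theorem integral_exp_neg_mul_one_add_inv_phaseInv {n : ℕ} (hn : 0 < n) :
    ∫ v in Set.Ioi 0, Real.exp (-(n * v)) * (1 + 1 / phaseInv v) = (1 + R 1 n) / n := by
  rw [← integral_comp_phase,
    setIntegral_congr_fun measurableSet_Ioi (eqOn_exp_neg_mul_one_add_inv_phaseInv n),
    integral_one_add_pow_mul_exp_neg_mul n (Nat.cast_pos.2 hn), one_add_R_one, Finset.sum_div]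
  refine Finset.sum_congr rfl fun k _ => ?_
  rw [distinctProb, pow_succ, div_div]

theorem integral_exp_neg_mul_remainder_phaseInv {n : ℕ} (hn : 0 < n) :
    ∫ v in Set.Ioi 0, Real.exp (-(n * v)) * remainder (phaseInv v) = kappa n / n := by
  have hn' : (0 : ℝ) < n := Nat.cast_pos.2 hn
  have hsplit : Set.EqOn (fun v => Real.exp (-(n * v)) * remainder (phaseInv v))
      (fun v => Real.exp (-(n * v)) * (1 + 1 / phaseInv v) - Real.exp (-(n * v)) / √(2 * v)
        - 2 / 3 * (v ^ 0 * Real.exp (-(n * v)))) (Set.Ioi 0) := by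
    intro v hv
    simp only [remainder, phase_phaseInv hv]
    ring
  have hsqrt : √(Real.pi / (2 * n)) = √(Real.pi * n / 2) / n := by
    rw [← Real.sqrt_sq hn'.le, ← Real.sqrt_div' _ (sq_nonneg _), Real.sqrt_sq hn'.le]
    congr 1
    field_simp
  have hinv := integrableOn_exp_neg_mul_one_add_inv_phaseInv hn
  have hroot := integrableOn_exp_neg_mul_div_sqrt hn'
  have hdiff : IntegrableOn (fun v => Real.exp (-(n * v)) * (1 + 1 / phaseInv v)
      - Real.exp (-(n * v)) / √(2 * v)) (Set.Ioi 0) := hinv.sub hroot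
  rw [setIntegral_congr_fun measurableSet_Ioi hsplit,
    integral_sub hdiff ((integrableOn_pow_mul_exp_neg_mul 0 hn').const_mul _),
    integral_sub hinv hroot, integral_exp_neg_mul_one_add_inv_phaseInv hn,
    integral_exp_neg_mul_div_sqrt hn', integral_const_mul, integral_pow_mul_exp_neg_mul 0 hn',
    hsqrt, kappa_eq]
  simp only [Nat.factorial_zero, Nat.cast_one, zero_add, pow_one]
  ring

/-- The Laplace integral that extends `kappa` to real arguments `c > 0`. -/
noncomputable def kappaReal (c : ℝ) : ℝ :=
  ∫ w in Set.Ioi 0, Real.exp (-w) * remainder (phaseInv (w / c))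

theorem kappa_eq_kappaReal {n : ℕ} (hn : 0 < n) : kappa n = kappaReal n := by
  have hn' : (n : ℝ) ≠ 0 := by positivity
  have h := integral_comp_mul_left_Ioi
    (fun w => Real.exp (-w) * remainder (phaseInv (w / n))) 0 (Nat.cast_pos.2 hn : (0 : ℝ) < n)
  simp only [mul_div_cancel_left₀ _ hn', mul_zero, smul_eq_mul,
    integral_exp_neg_mul_remainder_phaseInv hn] at h
  rw [kappaReal]
  field_simp at h
  exact h

theorem setIntegral_lt_setIntegral {α : Type*} [MeasurableSpace α] {μ : Measure α} {s : Set α}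
    (hs : MeasurableSet s) (hμ : μ s ≠ 0) {f g : α → ℝ} (hf : IntegrableOn f s μ)
    (hg : IntegrableOn g s μ) (hfg : ∀ x ∈ s, f x < g x) :
    ∫ x in s, f x ∂μ < ∫ x in s, g x ∂μ := by
  have hsupp : Function.support (fun x => g x - f x) ∩ s = s :=
    Set.inter_eq_right.2 fun x hx => (sub_pos.2 (hfg x hx)).ne'
  rw [← sub_pos, ← integral_sub hg hf, setIntegral_pos_iff_support_of_nonneg_ae
    (ae_restrict_of_forall_mem hs fun x hx => (sub_pos.2 (hfg x hx)).le) (hg.sub hf), hsupp]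
  exact pos_iff_ne_zero.2 hμ

theorem aestronglyMeasurable_exp_neg_mul_remainder {c : ℝ} (hc : 0 < c) :
    AEStronglyMeasurable (fun w => Real.exp (-w) * remainder (phaseInv (w / c)))
      (volume.restrict (Set.Ioi 0)) := by
  have hmono : MonotoneOn (fun w => remainder (phaseInv (w / c))) (Set.Ioi 0) :=
    fun v hv w hw hvw => strictMonoOn_remainder.monotoneOn
      (phaseInv_pos (div_pos hv hc)) (phaseInv_pos (div_pos hw hc))
      (strictMonoOn_phaseInv.monotoneOn (div_pos hv hc) (div_pos hw hc) (by gcongr))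
  exact ((Real.measurable_exp.comp measurable_neg).aemeasurable.mul
    (aemeasurable_restrict_of_monotoneOn measurableSet_Ioi hmono)).aestronglyMeasurable

theorem norm_exp_neg_mul_remainder_le {c w : ℝ} (hc : 0 < c) (hw : 0 < w) :
    ‖Real.exp (-w) * remainder (phaseInv (w / c))‖ ≤ Real.exp (-w) := by
  have ht := phaseInv_pos (div_pos hw hc)
  rw [Real.norm_of_nonneg (mul_nonneg (Real.exp_pos _).le (remainder_pos ht).le)]
  exact mul_le_of_le_one_right (Real.exp_pos _).le (by linarith [remainder_lt_one_third ht])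

theorem integrableOn_exp_neg_mul_remainder {c : ℝ} (hc : 0 < c) :
    IntegrableOn (fun w => Real.exp (-w) * remainder (phaseInv (w / c))) (Set.Ioi 0) :=
  (integrableOn_exp_neg_Ioi 0).mono' (aestronglyMeasurable_exp_neg_mul_remainder hc)
    (ae_restrict_of_forall_mem measurableSet_Ioi fun _ hw => norm_exp_neg_mul_remainder_le hc hw)

theorem strictAntiOn_kappaReal : StrictAntiOn kappaReal (Set.Ioi 0) := by
  intro c hc d hd hcd
  refine setIntegral_lt_setIntegral measurableSet_Ioi (by simp)
    (integrableOn_exp_neg_mul_remainder hd) (integrableOn_exp_neg_mul_remainder hc) fun w hw => ?_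
  have hw : 0 < w := hw
  have hwc := div_pos hw hc
  have hwd := div_pos hw hd
  gcongr
  exact strictMonoOn_remainder (phaseInv_pos hwd) (phaseInv_pos hwc)
    (strictMonoOn_phaseInv hwd hwc (div_lt_div_of_pos_left hw hc hcd))

theorem tendsto_remainder_phaseInv_div {w : ℝ} (hw : 0 < w) :
    Tendsto (fun c => remainder (phaseInv (w / c))) atTop (𝓝 0) := by
  have hdiv : Tendsto (fun c => w / c) atTop (𝓝[>] 0) :=
    tendsto_nhdsWithin_iff.2 ⟨tendsto_const_nhds.div_atTop tendsto_id,
      (eventually_gt_atTop 0).mono fun c hc => div_pos hw hc⟩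
  exact tendsto_remainder.comp (tendsto_phaseInv.comp hdiv)

theorem tendsto_kappaReal : Tendsto kappaReal atTop (𝓝 0) := by
  have h := tendsto_integral_filter_of_dominated_convergence (μ := volume.restrict (Set.Ioi 0))
    (F := fun c w => Real.exp (-w) * remainder (phaseInv (w / c))) (f := fun _ => 0) (l := atTop)
    (fun w => Real.exp (-w))
    ((eventually_gt_atTop 0).mono fun c hc => aestronglyMeasurable_exp_neg_mul_remainder hc)
    ((eventually_gt_atTop 0).mono fun c hc => ae_restrict_of_forall_mem measurableSet_Ioi
      fun w hw => norm_exp_neg_mul_remainder_le hc hw)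
    (integrableOn_exp_neg_Ioi 0)
    (ae_restrict_of_forall_mem measurableSet_Ioi fun w hw => by
      simpa using (tendsto_remainder_phaseInv_div hw).const_mul (Real.exp (-w)))
  rwa [integral_zero] at h

theorem strictAntiOn_kappa : StrictAntiOn kappa (Set.Ici 1) := by
  intro m hm n hn hmn
  rw [kappa_eq_kappaReal hm, kappa_eq_kappaReal hn]
  exact strictAntiOn_kappaReal (Set.mem_Ioi.2 (Nat.cast_pos.2 hm))
    (Set.mem_Ioi.2 (Nat.cast_pos.2 hn)) (Nat.cast_lt.2 hmn)

theorem tendsto_kappa : Tendsto kappa atTop (𝓝 0) :=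
  (tendsto_kappaReal.comp tendsto_natCast_atTop_atTop).congr' <|
    (eventually_gt_atTop 0).mono fun _ hn => (kappa_eq_kappaReal hn).symm

end Linear

theorem theorem9 :
    (∀ (n : ℕ), 1 ≤ n →
      ∀ (Ω : Type*) [MeasurableSpace Ω] (P : Measure Ω) [IsProbabilityMeasure P]
        (x : Fin n → Ω → Fin n), (∀ i, Measurable (x i)) → iIndepFun x P →
        (∀ i k, P.real {ω | x i ω = k} = 1 / (n : ℝ)) →
        (∫ ω, (Linear.comparisons (fun i => x i ω) : ℝ) ∂P)
            = 1 - (n ! : ℝ) / (n : ℝ) ^ n + Linear.R 1 n ∧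
        (∫ ω, (Linear.comparisons (fun i => x i ω) : ℝ) ∂P)
            = √(Real.pi * n / 2) + 2 / 3 + Linear.kappa n - (n ! : ℝ) / (n : ℝ) ^ n) ∧
    StrictAntiOn Linear.kappa (Set.Ici 1) ∧
    Tendsto Linear.kappa atTop (𝓝 0) := by
  refine ⟨fun n _ Ω _ P _ x hx hind hunif => ?_, Linear.strictAntiOn_kappa, Linear.tendsto_kappa⟩
  have hcost := Linear.integral_comparisons hx hind hunif
  refine ⟨hcost, hcost.trans ?_⟩
  rw [Linear.kappa_eq]
  ring
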